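/- For graphs $T$ and $G$ let $m_T(G)$ be the number of unlabelled copies of $T$ in $G$ (the number of subgraphs of $G$ isomorphic to $T$). Write $G\to(H_1,\dots,H_q)$ if every $q$-edge-colouring of $G$ has, for some $j\in\{1,\dots,q\}$, a copy of $H_j$ all of whose edges have colour $j$. Define $$\mathbf{GRT}_T(n\to(H_1,\dots,H_q))=\max\{m_T(G) : |V(G)|=n,\ G\not\to(H_1,\dots,H_q)\}$$ and $\mathbf{GRT}_\ell=\mathbf{GRT}_{K_\ell}$. Let $tK_2$ denote a matching with $t$ edges and, for a vector $\mathbf t=(t_1,\dots,t_q)$ of positive integers, put $\mathbf tK_2=(t_1K_2,\dots,t_qK_2)$, $\|\mathbf t\|_\infty=\max_i t_i$ and $\Lambda_{\mathbf t}=\sum_{i=1}^q(t_i-1)$. Finally let $$\phi_{\ell,n}(x,y)=\binom{x+y}{\ell}+\binom{y}{\ell-1}(n-x-y).$$ **Theorem.** Let $q\ge 1$, $\ell\ge 2$ and $n\ge 0$ be integers and let $\mathbf t=(t_1,\dots,t_q)$ be a vector of positive integers. 1. If $n\ge\max\{\ell,\ \|\mathbf t\|_\infty+\Lambda_{\mathbf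 t}\}$, then $$\mathbf{GRT}_\ell(n\to\mathbf tK_2)=\max\bigl\{\phi_{\ell,n}(1,\Lambda_{\mathbf t}),\ \phi_{\ell,n}(2\|\mathbf t\|_\infty-1,\ \Lambda_{\mathbf t}-\|\mathbf t\|_\infty+1)\bigr\}.$$ 2. If $n<\ell$, then $\mathbf{GRT}_\ell(n\to\mathbf tK_2)=0$. 3. If $\ell\le n\le\|\mathbf t\|_\infty+\Lambda_{\mathbf t}$, then $\mathbf{GRT}_\ell(n\to\mathbf tK_2)=\binom n\ell$. -/

import Mathlib

namespace GenRT

open SimpleGraph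

/-- The matching `tK₂`: `t` pairwise disjoint edges `{(i, 0), (i, 1)}`, on `2 * t` vertices. -/
def matchingGraph (t : ℕ) : SimpleGraph (Fin t × Fin 2) where
  Adj a b := a.1 = b.1 ∧ a.2 ≠ b.2
  symm := ⟨fun _ _ h => ⟨h.1.symm, h.2.symm⟩⟩
  loopless := ⟨fun _ h => h.2 rfl⟩

/-- `G → (H₁, …, H_q)`: every `q`-edge-colouring of `G` has, for some colour `j`,
a copy of `H_j` all of whose edges have colour `j`. -/
def Arrows {V : Type*} (G : SimpleGraph V) {q : ℕ} {W : Fin q → Type*}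
    (H : ∀ j, SimpleGraph (W j)) : Prop :=
  ∀ C : G.EdgeLabeling (Fin q), ∃ j, H j ⊑ C.labelGraph j

/-- The numbers `m_T(G)` of unlabelled copies of `T` in `G`, over all graphs `G` on `n` vertices
with `G ↛ (H₁, …, H_q)`. -/
def grtValues {U : Type*} (T : SimpleGraph U) (n : ℕ) {q : ℕ} {W : Fin q → Type*}
    (H : ∀ j, SimpleGraph (W j)) : Set ℕ :=
  {m | ∃ G : SimpleGraph (Fin n), ¬ Arrows G H ∧ G.copyCount T = m}

/-- The generalised Ramsey–Turán number `GRT_T(n → (H₁, …, H_q))`: the largest element of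
`grtValues T n H` (a finite set, so that the supremum is a maximum whenever it is nonempty). -/
noncomputable def GRT {U : Type*} (T : SimpleGraph U) (n : ℕ) {q : ℕ} {W : Fin q → Type*}
    (H : ∀ j, SimpleGraph (W j)) : ℕ :=
  sSup (grtValues T n H)

/-- `GRT_ℓ(n → (t₁K₂, …, t_qK₂))`, the case in which copies of `K_ℓ` are counted and the forbidden
graphs are matchings. -/
noncomputable def matchingGRT (ℓ n : ℕ) {q : ℕ} (t : Fin q → ℕ) : ℕ :=
  GRT (⊤ : SimpleGraph (Fin ℓ)) n (fun j => matchingGraph (t j))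

/-- `‖t‖_∞ = max_i t_i`. -/
def supNorm {q : ℕ} (t : Fin q → ℕ) : ℕ := Finset.univ.sup t

/-- `Λ_t = ∑ i, (t_i - 1)`, used for `t` with all `t_i ≥ 1`. -/
def Lam {q : ℕ} (t : Fin q → ℕ) : ℕ := ∑ i, (t i - 1)

/-- `φ_{ℓ,n}(x, y) = C(x + y, ℓ) + C(y, ℓ - 1) (n - x - y)`, used for `ℓ ≥ 1`. -/
def phi (ℓ n x y : ℕ) : ℤ :=
  ((x + y).choose ℓ : ℤ) + (y.choose (ℓ - 1) : ℤ) * ((n : ℤ) - x - y)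

theorem finite_grtValues {U : Type*} (T : SimpleGraph U) (n : ℕ) {q : ℕ} {W : Fin q → Type*}
    (H : ∀ j, SimpleGraph (W j)) : (grtValues T n H).Finite :=
  (Set.finite_range fun G : SimpleGraph (Fin n) => G.copyCount T).subset
    fun _ ⟨G, _, hG⟩ => ⟨G, hG⟩

/-- For matchings with all `t_i ≥ 1` (and also for no colours at all) the maximum is over a
nonempty set and is attained. -/
theorem isGreatest_matchingGRT (ℓ n : ℕ) {q : ℕ} (t : Fin q → ℕ) (ht : ∀ i, 1 ≤ t i) :
    IsGreatest (grtValues (⊤ : SimpleGraph (Fin ℓ)) n (fun j => matchingGraph (t j)))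
      (matchingGRT ℓ n t) := by
  have hf := finite_grtValues (⊤ : SimpleGraph (Fin ℓ)) n (fun j => matchingGraph (t j))
  have hne : (grtValues (⊤ : SimpleGraph (Fin ℓ)) n (fun j => matchingGraph (t j))).Nonempty := by
    refine ⟨_, ⊥, fun h => ?_, rfl⟩
    obtain ⟨j, ⟨f⟩⟩ := h fun e => absurd e.2 (by simp)
    have hadj : (matchingGraph (t j)).Adj (⟨0, ht j⟩, 0) (⟨0, ht j⟩, 1) := ⟨rfl, by simp⟩
    exact (EdgeLabeling.labelGraph_le _ (f.toHom.map_adj hadj) : (⊥ : SimpleGraph (Fin n)).Adj _ _)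
  exact ⟨Nat.sSup_mem hne hf.bddAbove, fun _ hm => le_csSup hf.bddAbove hm⟩

/-- `Λ_t - ‖t‖_∞ + 1` is nonnegative, so that `Λ_t + 1 - ‖t‖_∞` is never truncated. -/
theorem supNorm_le_Lam_add_one {q : ℕ} (t : Fin q → ℕ) : supNorm t ≤ Lam t + 1 := by
  refine Finset.sup_le fun i _ => ?_
  have : t i - 1 ≤ Lam t :=
    Finset.single_le_sum (f := fun i => t i - 1) (fun _ _ => Nat.zero_le _) (Finset.mem_univ i)
  omega

end GenRT

/-! A matching-free colour class has a rigid structure. By Tutte–Berge, the edges of colour `j` all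
meet a set `S j` or lie in blocks, with |S j| + ∑ ⌊|B|/2⌋ ≤ t_j − 1
(`exists_cover_of_matchingGraph_free`). Pooling the colours gives one cover of `G` of weight at most
Λ, in which each block has half-size at most ‖t‖_∞ − 1.

The key step, `exists_small_set_degree_le`, extracts a single parameter a ≤ ‖t‖_∞ − 1 and a set of
at most Λ + a + 1 vertices outside of which all degrees are at most Λ − a. Counting cliques inside
the set, and at each vertex outside it, gives the bound φ(2a + 1, Λ − a). This is convex in a, so
the extremes a = 0 and a = ‖t‖_∞ − 1 dominate, and they are the two terms of the maximum.

Both extremes are attained: `coreGraph n (2a+1) (Λ-a)` has a good colouring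
(`not_arrows_coreGraph`). For small n and a = ‖t‖_∞ − 1 this graph is complete, which settles the
third case. -/

open Finset

/-! ### Block covers, degrees and clique counts -/

/-- A cover of the edges of a complete graph on `M` by proper cliques `B i ∩ M` satisfies
`∑ (|B i ∩ M| - 1) ≥ 2 |M| - 3`. -/
theorem two_mul_card_le_of_proper_clique_cover {α ι : Type*} [DecidableEq α] [DecidableEq ι]
    (s : Finset ι) (B : ι → Finset α) (M : Finset α) (hM : 2 ≤ #M)
    (hcov : ∀ u ∈ M, ∀ v ∈ M, u ≠ v → ∃ i ∈ s, u ∈ B i ∧ v ∈ B i)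
    (hproper : ∀ i ∈ s, ¬ M ⊆ B i) :
    2 * #M ≤ 3 + ∑ i ∈ s, (#(B i ∩ M) - 1) := by
  induction M using Finset.strongInduction with
  | H M ih =>
    obtain ⟨v, hv⟩ : M.Nonempty := card_pos.1 (by omega)
    have hcard : #(M.erase v) + 1 = #M := card_erase_add_one hv
    -- If one block contains all of `M` but `v`, it contributes |M| − 2, and the blocks through `v`,
    -- which must reach every other vertex, contribute |M| − 1.
    by_cases hfull : ∃ i ∈ s, M.erase v ⊆ B i
    · obtain ⟨i₀, hi₀, hsub⟩ := hfull
      have hv₀ : v ∉ B i₀ := fun h => hproper i₀ hi₀ fun x hx => by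
        by_cases hxv : x = v
        · exact hxv ▸ h
        · exact hsub (mem_erase.2 ⟨hxv, hx⟩)
      have h₀ : #(M.erase v) ≤ #(B i₀ ∩ M) :=
        card_le_card fun x hx => mem_inter.2 ⟨hsub hx, mem_of_mem_erase hx⟩
      have h₁ : #(M.erase v) ≤ ∑ i ∈ s with v ∈ B i, (#(B i ∩ M) - 1) := by
        calc #(M.erase v) ≤ #((s.filter fun i => v ∈ B i).biUnion fun i => (B i ∩ M).erase v) := by
              refine card_le_card fun x hx => ?_
              obtain ⟨hxv, hxM⟩ := mem_erase.1 hx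
              obtain ⟨i, hi, hvi, hxi⟩ := hcov v hv x hxM (Ne.symm hxv)
              simp only [mem_biUnion, mem_filter, mem_erase, mem_inter]
              exact ⟨i, ⟨hi, hvi⟩, hxv, hxi, hxM⟩
          _ ≤ ∑ i ∈ s with v ∈ B i, #((B i ∩ M).erase v) := card_biUnion_le
          _ = _ := sum_congr rfl fun i hi =>
              card_erase_of_mem (mem_inter.2 ⟨(mem_filter.1 hi).2, hv⟩)
      have h₂ : (#(B i₀ ∩ M) - 1) + ∑ i ∈ s with v ∈ B i, (#(B i ∩ M) - 1) ≤
          ∑ i ∈ s, (#(B i ∩ M) - 1) := by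
        rw [← sum_insert (f := fun i => #(B i ∩ M) - 1) (by simp [hv₀])]
        exact sum_le_sum_of_subset (insert_subset hi₀ (filter_subset _ _))
      omega
    -- Otherwise induct on `M.erase v`: as blocks are proper, `v` meets the rest of `M` in at least
    -- two blocks, and each loses one from its term.
    · push Not at hfull
      obtain ⟨u, hu⟩ : (M.erase v).Nonempty := card_pos.1 (by omega)
      obtain ⟨huv, huM⟩ := mem_erase.1 hu
      obtain ⟨i₁, hi₁, hv₁, hu₁⟩ := hcov v hv u huM (Ne.symm huv)
      obtain ⟨w, hwM, hw₁⟩ := not_subset.1 (hproper i₁ hi₁)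
      have hwv : w ≠ v := fun h => hw₁ (h ▸ hv₁)
      obtain ⟨i₂, hi₂, hv₂, hw₂⟩ := hcov v hv w hwM (Ne.symm hwv)
      have hne : i₁ ≠ i₂ := fun h => hw₁ (h ▸ hw₂)
      have huw : u ≠ w := fun h => hw₁ (h ▸ hu₁)
      have hpair : 2 ≤ #(M.erase v) := by
        rw [← card_pair huw]
        exact card_le_card (insert_subset hu (singleton_subset_iff.2 (mem_erase.2 ⟨hwv, hwM⟩)))
      have hrec := ih (M.erase v) (erase_ssubset hv) hpair
        (fun x hx y hy => hcov x (mem_of_mem_erase hx) y (mem_of_mem_erase hy)) hfull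
      -- The second vertex `x` keeps the truncated subtraction from hiding the loss.
      have hdrop : ∀ i, v ∈ B i → ∀ x, x ∈ B i → x ∈ M → x ≠ v →
          (#(B i ∩ M.erase v) - 1) + 1 ≤ #(B i ∩ M) - 1 := by
        intro i hvi x hxi hxM hxv
        have h₁ : #(B i ∩ M.erase v) + 1 = #(B i ∩ M) := by
          rw [inter_erase]
          exact card_erase_add_one (mem_inter.2 ⟨hvi, hv⟩)
        have h₂ : 0 < #(B i ∩ M.erase v) :=
          card_pos.2 ⟨x, mem_inter.2 ⟨hxi, mem_erase.2 ⟨hxv, hxM⟩⟩⟩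
        omega
      have hstep : ∑ i ∈ s, (#(B i ∩ M.erase v) - 1) + #({i₁, i₂} : Finset ι) ≤
          ∑ i ∈ s, (#(B i ∩ M) - 1) := by
        have hsub : ({i₁, i₂} : Finset ι) ⊆ s :=
          insert_subset hi₁ (singleton_subset_iff.2 hi₂)
        have : #({i₁, i₂} : Finset ι) = ∑ i ∈ s, if i ∈ ({i₁, i₂} : Finset ι) then 1 else 0 := by
          rw [← sum_filter, filter_mem_eq_inter, inter_eq_right.2 hsub, card_eq_sum_ones]
        rw [this, ← sum_add_distrib]
        refine sum_le_sum fun i _ => ?_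
        split_ifs with hi
        · rcases mem_insert.1 hi with rfl | hi
          · exact hdrop _ hv₁ u hu₁ huM huv
          · rw [mem_singleton.1 hi]
            exact hdrop _ hv₂ w hw₂ hwM hwv
        · exact Nat.sub_le_sub_right
            (card_le_card (inter_subset_inter_left (erase_subset v M))) 1
      rw [card_pair hne] at hstep
      omega

/-- If every edge of `G` meets `S` or lies in a block `B i`, then all vertices outside a small
set have small degree. -/
theorem exists_small_set_degree_le {V ι : Type*} [Fintype V] [DecidableEq V] [Fintype ι]
    [DecidableEq ι] (G : SimpleGraph V) [DecidableRel G.Adj] (S : Finset V) (B : ι → Finset V)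
    (hcov : ∀ u v, G.Adj u v → u ∈ S ∨ v ∈ S ∨ ∃ i, u ∈ B i ∧ v ∈ B i) {L b : ℕ}
    (hL : #S + ∑ i, #(B i) / 2 ≤ L) (hb : ∀ i, #(B i) / 2 ≤ b) :
    ∃ a ≤ b, a ≤ L ∧ ∃ X : Finset V, #X ≤ L + a + 1 ∧ ∀ v ∉ X, G.degree v ≤ L - a := by
  set A := ∑ i, #(B i) / 2 with hA
  -- A block through `v` supplies at most |B| − 1 ≤ 2⌊|B|/2⌋ neighbours.
  have hdeg : ∀ v ∉ S, G.degree v ≤ #S + 2 * ∑ i with v ∈ B i, #(B i) / 2 := by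
    intro v hv
    rw [← G.card_neighborFinset_eq_degree]
    calc #(G.neighborFinset v)
        ≤ #(S ∪ (univ.filter fun i => v ∈ B i).biUnion fun i => (B i).erase v) := by
          refine card_le_card fun u hu => ?_
          have huv : G.Adj v u := (G.mem_neighborFinset v u).1 hu
          simp only [mem_union, mem_biUnion, mem_filter, mem_univ, true_and, mem_erase]
          rcases hcov v u huv with h | h | ⟨i, hi, hi'⟩
          · exact absurd h hv
          · exact Or.inl h
          · exact Or.inr ⟨i, hi, huv.ne', hi'⟩
      _ ≤ #S + ∑ i with v ∈ B i, #((B i).erase v) :=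
          (card_union_le _ _).trans (Nat.add_le_add_left card_biUnion_le _)
      _ ≤ #S + ∑ i with v ∈ B i, 2 * (#(B i) / 2) := by
          refine Nat.add_le_add_left (sum_le_sum fun i hi => ?_) _
          rw [card_erase_of_mem (mem_filter.1 hi).2]
          omega
      _ = _ := by rw [mul_sum]
  by_cases hbig : ∃ i, A < 2 * (#(B i) / 2)
  · obtain ⟨i₀, hi₀⟩ := hbig
    have hle : #(B i₀) / 2 ≤ A :=
      single_le_sum (f := fun i => #(B i) / 2) (fun _ _ => Nat.zero_le _) (mem_univ i₀)
    have := hb i₀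
    -- One block holds more than half of the weight `A`. This `a` makes 2⌊|B i₀|/2⌋ + 1 equal to A +
    -- a + 1, while vertices outside `B i₀` see weight at most A − ⌊|B i₀|/2⌋, twice which is A − a.
    refine ⟨2 * (#(B i₀) / 2) - A, by omega, by omega, S ∪ B i₀, ?_, fun v hv => ?_⟩
    · have := card_union_le S (B i₀)
      omega
    · rw [mem_union, not_or] at hv
      have h₁ := hdeg v hv.1
      have h₂ : #(B i₀) / 2 + ∑ i with v ∈ B i, #(B i) / 2 ≤ A := by
        rw [← sum_insert (f := fun i => #(B i) / 2) (by simp [hv.2])]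
        exact sum_le_sum_of_subset (subset_univ _)
      omega
  · push Not at hbig
    -- No block dominates, so a = 0 works: `M` collects the vertices seeing more than half of the
    -- weight. Two of them cannot have disjoint families of blocks, so the blocks cover all pairs in
    -- `M`.
    set M : Finset V := univ.filter fun v => A < 2 * ∑ i with v ∈ B i, #(B i) / 2 with hM
    refine ⟨0, Nat.zero_le _, Nat.zero_le _, S ∪ M, ?_, fun v hv => ?_⟩
    · have hMA : #M ≤ A + 1 := by
        by_contra! hlt
        have hcl : ∀ u ∈ M, ∀ v ∈ M, u ≠ v → ∃ i ∈ univ, u ∈ B i ∧ v ∈ B i := by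
          intro u hu v hv _
          by_contra! hno
          have hdisj : Disjoint (univ.filter fun i => u ∈ B i) (univ.filter fun i => v ∈ B i) :=
            disjoint_filter.2 fun i hi hui => hno i hi hui
          have hle : ∑ i with u ∈ B i, #(B i) / 2 + ∑ i with v ∈ B i, #(B i) / 2 ≤ A := by
            rw [← sum_union hdisj]
            exact sum_le_sum_of_subset (subset_univ _)
          have h₁ := (mem_filter.1 hu).2
          have h₂ := (mem_filter.1 hv).2
          omega
        -- Blocks have at most A + 1 vertices, hence are proper in `M` if |M| ≥ A + 2; then 2A + 4 ≤
        -- 3 + 2A, a contradiction.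
        have h₁ := two_mul_card_le_of_proper_clique_cover univ B M (by omega) hcl fun i _ hsub => by
          have := card_le_card hsub
          have := hbig i
          omega
        have h₂ : ∑ i, (#(B i ∩ M) - 1) ≤ 2 * A := by
          rw [hA, mul_sum]
          refine sum_le_sum fun i _ => ?_
          have := card_le_card (inter_subset_left : B i ∩ M ⊆ B i)
          omega
        omega
      have := card_union_le S M
      omega
    · rw [mem_union, not_or] at hv
      have h₁ := hdeg v hv.1
      have h₂ : ¬ A < 2 * ∑ i with v ∈ B i, #(B i) / 2 := fun h =>
        hv.2 (mem_filter.2 ⟨mem_univ v, h⟩)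
      omega

/-- Cliques inside `X` or containing a vertex of degree at most `d` outside `X`. -/
theorem card_cliqueFinset_le_of_degree_le {V : Type*} [Fintype V] [DecidableEq V]
    (G : SimpleGraph V) [DecidableRel G.Adj] {ℓ : ℕ} (X : Finset V) {d : ℕ}
    (hd : ∀ v ∉ X, G.degree v ≤ d) :
    #(G.cliqueFinset ℓ) ≤ (#X).choose ℓ + (Fintype.card V - #X) * d.choose (ℓ - 1) := by
  calc #(G.cliqueFinset ℓ)
      ≤ #(powersetCard ℓ X ∪
          Xᶜ.biUnion fun v => (powersetCard (ℓ - 1) (G.neighborFinset v)).image (insert v)) := by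
        refine card_le_card fun s hs => ?_
        obtain ⟨hcl, hcard⟩ := G.mem_cliqueFinset_iff.1 hs
        by_cases hsX : s ⊆ X
        · exact mem_union_left _ (mem_powersetCard.2 ⟨hsX, hcard⟩)
        · obtain ⟨v, hvs, hvX⟩ := not_subset.1 hsX
          refine mem_union_right _ (mem_biUnion.2 ⟨v, mem_compl.2 hvX, mem_image.2
            ⟨s.erase v, mem_powersetCard.2 ⟨fun u hu => ?_, ?_⟩, insert_erase hvs⟩⟩)
          · obtain ⟨huv, hus⟩ := mem_erase.1 hu
            exact (G.mem_neighborFinset v u).2 (hcl hvs hus huv.symm)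
          · rw [card_erase_of_mem hvs, hcard]
    _ ≤ #(powersetCard ℓ X) +
        ∑ v ∈ Xᶜ, #((powersetCard (ℓ - 1) (G.neighborFinset v)).image (insert v)) :=
        (card_union_le _ _).trans (Nat.add_le_add_left card_biUnion_le _)
    _ ≤ (#X).choose ℓ + ∑ v ∈ Xᶜ, d.choose (ℓ - 1) := by
        rw [card_powersetCard]
        refine Nat.add_le_add_left (sum_le_sum fun v hv => card_image_le.trans ?_) _
        rw [card_powersetCard, G.card_neighborFinset_eq_degree]
        exact Nat.choose_le_choose _ (hd v (mem_compl.1 hv))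
    _ = _ := by rw [sum_const, card_compl, smul_eq_mul]

/-- A discretely convex function is bounded by its values at the ends of an interval. -/
theorem le_max_of_discrete_convex (f : ℕ → ℤ) {b : ℕ}
    (hf : ∀ a, a + 2 ≤ b → f (a + 1) - f a ≤ f (a + 2) - f (a + 1)) {a : ℕ} (ha : a ≤ b) :
    f a ≤ max (f 0) (f b) := by
  -- By convexity, a descent at `a` forces descents at all earlier points.
  have hdown : ∀ a, a + 1 ≤ b → f (a + 1) < f a → f a ≤ f 0 := by
    intro a
    induction a with
    | zero => exact fun _ _ => le_rfl
    | succ a ih =>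
      intro hab hlt
      have h₁ : f (a + 2) < f (a + 1) := hlt
      have h₂ := hf a hab
      have h₃ : f (a + 1) < f a := by omega
      exact h₃.le.trans (ih (by omega) h₃)
  obtain ⟨c, rfl⟩ := Nat.exists_eq_add_of_le ha
  clear ha
  induction c with
  | zero => exact le_max_right _ _
  | succ c ih =>
    have h₁ := ih (fun a' ha' => hf a' (by omega)) fun a' ha' => hdown a' (by omega)
    have h₂ := hdown (a + c) (by omega)
    have h₃ : f (a + c) ≤ max (f 0) (f (a + (c + 1))) := by
      by_cases h : f (a + c + 1) < f (a + c)
      · exact le_max_of_le_left (h₂ h)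
      · exact le_max_of_le_right (not_lt.1 h)
    exact h₁.trans (max_le (le_max_left _ _) h₃)

/-! ### Convexity of φ along the family of core graphs -/

namespace GenRT

/-- Along this family x + y = L + a + 1, so the first binomial is convex in a. The second term is a
product of two nonnegative, nonincreasing, convex factors, hence convex too; ℓ ≥ 2 and L + b + 1 ≤ n
ensure this. -/
theorem phi_le_max {ℓ n L b a : ℕ} (hℓ : 2 ≤ ℓ) (hbL : b ≤ L) (hn : L + b + 1 ≤ n) (hab : a ≤ b) :
    phi ℓ n (2 * a + 1) (L - a) ≤ max (phi ℓ n 1 L) (phi ℓ n (2 * b + 1) (L - b)) := by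
  refine le_max_of_discrete_convex (fun a => phi ℓ n (2 * a + 1) (L - a)) (fun a ha => ?_) hab
  obtain ⟨p, rfl⟩ := Nat.exists_eq_add_of_le' hℓ
  obtain ⟨M, rfl⟩ : ∃ M, L = M + (a + 2) := ⟨L - (a + 2), by omega⟩
  obtain ⟨N, rfl⟩ : ∃ N, n = M + (a + 2) + (a + 2) + 1 + N :=
    ⟨n - (M + (a + 2) + (a + 2) + 1), by omega⟩
  have e₀ : 2 * a + 1 + (M + (a + 2) - a) = M + 2 * a + 3 := by omega
  have e₁ : 2 * (a + 1) + 1 + (M + (a + 2) - (a + 1)) = M + 2 * a + 4 := by omega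
  have e₂ : 2 * (a + 2) + 1 + (M + (a + 2) - (a + 2)) = M + 2 * a + 5 := by omega
  have d₀ : M + (a + 2) - a = M + 2 := by omega
  have d₁ : M + (a + 2) - (a + 1) = M + 1 := by omega
  have d₂ : M + (a + 2) - (a + 2) = M := by omega
  have hp : p + 2 - 1 = p + 1 := by omega
  simp only [phi, e₀, e₁, e₂]
  rw [d₀, d₁, d₂, hp, Nat.choose_succ_succ (M + 2 * a + 4) (p + 1),
    Nat.choose_succ_succ (M + 2 * a + 3) (p + 1), Nat.choose_succ_succ (M + 2 * a + 3) p,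
    Nat.choose_succ_succ (M + 1) p, Nat.choose_succ_succ M p]
  have h₁ : M.choose p ≤ (M + 1).choose p := Nat.choose_le_succ M p
  push_cast
  have h₂ : ((M.choose p : ℕ) : ℤ) ≤ ((M + 1).choose p : ℕ) := by exact_mod_cast h₁
  have h₃ : (0 : ℤ) ≤ (M.choose p : ℕ) := Int.natCast_nonneg _
  have h₄ : (0 : ℤ) ≤ ((M + 2 * a + 3).choose p : ℕ) := Int.natCast_nonneg _
  have h₅ : (0 : ℤ) ≤ N := Int.natCast_nonneg _
  nlinarith [mul_nonneg h₅ (sub_nonneg.2 h₂)]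

end GenRT

/-! ### The Tutte–Berge cover -/

namespace GenRT
open SimpleGraph

/-- The graph obtained from `H` by adding `r` new vertices adjacent to everything. -/
def addUniversal {V : Type*} (H : SimpleGraph V) (r : ℕ) : SimpleGraph (V ⊕ Fin r) where
  Adj a b := a ≠ b ∧ ∀ u v, a = Sum.inl u → b = Sum.inl v → H.Adj u v
  symm := ⟨fun _ _ h => ⟨h.1.symm, fun u v hu hv => (h.2 v u hv hu).symm⟩⟩
  loopless := ⟨fun _ h => h.1 rfl⟩

theorem matchingGraph_isContained_of_injective {V : Type*} {H : SimpleGraph V} {k : ℕ}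
    (x y : Fin k → V) (hx : x.Injective) (hy : y.Injective) (hxy : ∀ i j, x i ≠ y j)
    (hadj : ∀ i, H.Adj (x i) (y i)) : matchingGraph k ⊑ H := by
  refine ⟨⟨⟨fun a => if a.2 = 0 then x a.1 else y a.1, ?_⟩, ?_⟩⟩
  · rintro ⟨i, a⟩ ⟨j, b⟩ ⟨h₁, h₂⟩
    obtain rfl : i = j := h₁
    fin_cases a <;> fin_cases b <;> simp_all [(hadj _).symm]
  · rintro ⟨i, a⟩ ⟨j, b⟩ h
    fin_cases a <;> fin_cases b
    · simpa using hx h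
    · exact absurd h (hxy i j)
    · exact absurd h.symm (hxy j i)
    · simpa using hy h

/-- At most `r` old vertices are matched to new ones, so at least 2k old vertices are matched among
themselves, by edges of `H`. -/
theorem matchingGraph_isContained_of_addUniversal {V : Type*} [Fintype V] [LinearOrder V]
    {H : SimpleGraph V} {r k : ℕ} (hcard : r + 2 * k ≤ Fintype.card V)
    {M : (addUniversal H r).Subgraph} (hM : M.IsPerfectMatching) : matchingGraph k ⊑ H := by
  classical
  choose f hf hfu using Subgraph.isPerfectMatching_iff.1 hM
  have hinv : ∀ w, f (f w) = w := fun w => (hfu (f w) w (hf w).symm).symm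
  have hinj : f.Injective := Function.LeftInverse.injective hinv
  set g : V → V := fun v => Sum.elim id (fun _ => v) (f (Sum.inl v)) with hg
  -- The order picks one endpoint of each matching edge inside `V`: `R` holds the smaller ones, `R'`
  -- the larger, and `Q` the vertices matched to new ones.
  set R : Finset V := univ.filter fun v => ∃ v', f (Sum.inl v) = Sum.inl v' ∧ v < v' with hR
  set R' : Finset V := univ.filter fun v => ∃ v', f (Sum.inl v) = Sum.inl v' ∧ v' < v with hR'
  set Q : Finset V := univ.filter fun v => ∃ i, f (Sum.inl v) = Sum.inr i with hQ
  have hgR : ∀ v ∈ R, f (Sum.inl v) = Sum.inl (g v) ∧ v < g v := by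
    intro v hv
    obtain ⟨v', h₁, h₂⟩ := (mem_filter.1 hv).2
    have : g v = v' := by simp [hg, h₁]
    rw [this]
    exact ⟨h₁, h₂⟩
  have hgR' : ∀ v ∈ R', f (Sum.inl v) = Sum.inl (g v) ∧ g v < v := by
    intro v hv
    obtain ⟨v', h₁, h₂⟩ := (mem_filter.1 hv).2
    have : g v = v' := by simp [hg, h₁]
    rw [this]
    exact ⟨h₁, h₂⟩
  have hRR' : #R' ≤ #R := by
    refine card_le_card_of_injOn g (fun v hv => ?_) fun u hu v hv huv => ?_
    · obtain ⟨h₁, h₂⟩ := hgR' v hv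
      refine mem_filter.2 ⟨mem_univ _, v, ?_, h₂⟩
      rw [← h₁, hinv]
    · have : f (Sum.inl u) = f (Sum.inl v) := by rw [(hgR' u hu).1, (hgR' v hv).1, huv]
      exact Sum.inl_injective (hinj this)
  have hQr : #Q ≤ r := by
    have h : #(Q.image fun v => f (Sum.inl v)) ≤ #((univ : Finset (Fin r)).image
        (Sum.inr : Fin r → V ⊕ Fin r)) := by
      refine card_le_card fun w hw => ?_
      obtain ⟨v, hv, rfl⟩ := mem_image.1 hw
      obtain ⟨i, hi⟩ := (mem_filter.1 hv).2
      exact mem_image.2 ⟨i, mem_univ i, hi.symm⟩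
    rw [card_image_of_injective Q (f := fun v => f (Sum.inl v))
      (hinj.comp Sum.inl_injective)] at h
    exact h.trans (card_image_le.trans (by simp))
  have hall : Fintype.card V ≤ #R + #R' + #Q := by
    have : (univ : Finset V) ⊆ (R ∪ R') ∪ Q := by
      intro v _
      simp only [mem_union, hR, hR', hQ, mem_filter, mem_univ, true_and]
      rcases hfv : f (Sum.inl v) with v' | i
      · rcases lt_trichotomy v v' with h | h | h
        · exact Or.inl (Or.inl ⟨v', rfl, h⟩)
        · subst h
          have := (hf (Sum.inl v)).ne
          exact absurd hfv.symm this
        · exact Or.inl (Or.inr ⟨v', rfl, h⟩)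
      · exact Or.inr ⟨i, rfl⟩
    have h₁ := card_le_card this
    have h₂ := card_union_le (R ∪ R') Q
    have h₃ := card_union_le R R'
    rw [card_univ] at h₁
    omega
  have hkR : k ≤ #R := by omega
  obtain ⟨T, hTR, hTk⟩ := exists_subset_card_eq hkR
  let e : Fin k ≃ T := (T.equivFinOfCardEq hTk).symm
  have he : ∀ i, (e i : V) ∈ R := fun i => hTR (e i).2
  refine matchingGraph_isContained_of_injective (fun i => (e i : V)) (fun i => g (e i))
    (Subtype.val_injective.comp e.injective) (fun i j hij => ?_) (fun i j hij => ?_) fun i => ?_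
  · have : f (Sum.inl (e i : V)) = f (Sum.inl (e j : V)) := by
      rw [(hgR _ (he i)).1, (hgR _ (he j)).1]
      exact congrArg Sum.inl hij
    exact e.injective (Subtype.val_injective (Sum.inl_injective (hinj this)))
  · have h₁ := hgR _ (he i)
    have h₂ := hgR _ (he j)
    have h₃ : f (Sum.inl (e i : V)) = Sum.inl (e j : V) := by
      rw [show (e i : V) = g (e j) from hij, ← h₂.1, hinv]
    have h₄ : g (e i) = (e j : V) := Sum.inl_injective (h₁.1.symm.trans h₃)
    have h₅ := h₁.2
    have h₆ := h₂.2
    rw [h₄] at h₅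
    rw [← show (e i : V) = g (e j) from hij] at h₆
    exact lt_asymm h₅ h₆
  · have h₁ := hgR _ (he i)
    have h₂ := (hf (Sum.inl (e i : V))).adj_sub
    exact h₂.2 _ _ rfl h₁.1

/-- The component partition left by a Tutte violator, counted in halves. -/
theorem two_mul_sum_half_add_ncard_oddComponents {W : Type*} [Fintype W] (K : SimpleGraph W)
    [Fintype K.ConnectedComponent] :
    2 * ∑ c : K.ConnectedComponent, c.supp.ncard / 2 + K.oddComponents.ncard = Nat.card W := by
  classical
  have h₁ : ∑ c : K.ConnectedComponent, c.supp.ncard = Nat.card W := by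
    rw [Nat.card_eq_fintype_card, ← card_univ,
      card_eq_sum_card_fiberwise (f := K.connectedComponentMk) (t := univ) (by simp)]
    refine sum_congr rfl fun c _ => ?_
    rw [← Set.ncard_coe_finset]
    congr 1
    ext w
    simp [ConnectedComponent.mem_supp_iff]
  have h₂ : K.oddComponents.ncard = ∑ c : K.ConnectedComponent, c.supp.ncard % 2 := by
    have : K.oddComponents = ((univ.filter fun c : K.ConnectedComponent => Odd c.supp.ncard :
        Finset K.ConnectedComponent) : Set K.ConnectedComponent) := by
      ext c
      simp
    rw [this, Set.ncard_coe_finset, card_filter]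
    refine sum_congr rfl fun c _ => ?_
    split_ifs with h
    · exact (Nat.odd_iff.1 h).symm
    · exact (Nat.even_iff.1 (Nat.not_odd_iff_even.1 h)).symm
  rw [h₂, ← h₁, mul_sum, ← sum_add_distrib]
  exact sum_congr rfl fun c _ => Nat.div_add_mod _ 2

/-- The covering form of the Tutte–Berge formula: a graph without `k + 1` disjoint edges has its
edges covered by a vertex set `S` and blocks `B i` with `|S| + ∑ ⌊|B i| / 2⌋ ≤ k`. -/
theorem exists_cover_of_matchingGraph_free {V : Type*} [Fintype V] [LinearOrder V]
    (H : SimpleGraph V) {k : ℕ} (hH : ¬ matchingGraph (k + 1) ⊑ H) :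
    ∃ (m : ℕ) (S : Finset V) (B : Fin m → Finset V),
      (∀ u v, H.Adj u v → u ∈ S ∨ v ∈ S ∨ ∃ i, u ∈ B i ∧ v ∈ B i) ∧
      #S + ∑ i, #(B i) / 2 ≤ k := by
  classical
  by_cases hsmall : Fintype.card V < 2 * k + 2
  · refine ⟨1, ∅, fun _ => univ, fun u v _ => Or.inr (Or.inr ⟨0, mem_univ u, mem_univ v⟩), ?_⟩
    simp only [card_empty, univ_unique, sum_const, card_singleton, card_univ, one_smul]
    omega
  -- With this many universal vertices, a perfect matching would leave k + 1 edges in `H`, so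
  -- Tutte's theorem supplies a violator.
  obtain ⟨r, hr⟩ : ∃ r, Fintype.card V = r + 2 * (k + 1) :=
    ⟨Fintype.card V - 2 * (k + 1), by omega⟩
  have hno : ¬ ∃ M : (addUniversal H r).Subgraph, M.IsPerfectMatching := fun ⟨M, hM⟩ =>
    hH (matchingGraph_isContained_of_addUniversal hr.ge hM)
  rw [tutte] at hno
  push Not at hno
  obtain ⟨U, hU⟩ := hno
  unfold IsTutteViolator at hU
  set K := ((⊤ : (addUniversal H r).Subgraph).deleteVerts U).coe with hK
  have hverts : ∀ w, w ∈ ((⊤ : (addUniversal H r).Subgraph).deleteVerts U).verts ↔ w ∉ U := by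
    intro w
    simp
  have hcardK : Nat.card ((⊤ : (addUniversal H r).Subgraph).deleteVerts U).verts + U.ncard =
      Fintype.card V + r := by
    have h₁ : ((⊤ : (addUniversal H r).Subgraph).deleteVerts U).verts = Uᶜ := by
      ext w
      rw [hverts]
      rfl
    rw [Nat.card_coe_set_eq, h₁, add_comm, Set.ncard_add_ncard_compl]
    simp
  have hsum := two_mul_sum_half_add_ncard_oddComponents K
  -- The total |V| + r is even, so the number of odd components has the parity of |U|, and exceeding
  -- |U| means exceeding it by 2.
  have hodd : U.ncard + 2 ≤ K.oddComponents.ncard := by omega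
  have hKadj : ∀ a b : ((⊤ : (addUniversal H r).Subgraph).deleteVerts U).verts,
      (addUniversal H r).Adj a b → K.Adj a b := by
    rintro ⟨a, ha⟩ ⟨b, hb⟩ hab
    rw [hverts] at ha hb
    simpa [hK, ha, hb] using hab
  -- A surviving universal vertex would connect everything, leaving at most one odd component.
  have hinr : ∀ i, Sum.inr i ∈ U := by
    intro i
    by_contra hi
    let x : ((⊤ : (addUniversal H r).Subgraph).deleteVerts U).verts :=
      ⟨Sum.inr i, (hverts _).2 hi⟩
    have hone : ∀ c : K.ConnectedComponent, c = K.connectedComponentMk x := by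
      intro c
      induction c using ConnectedComponent.ind with
      | h w =>
        by_cases hw : x = w
        · rw [hw]
        · refine (ConnectedComponent.sound (hKadj x w ?_).reachable).symm
          exact ⟨fun h => hw (Subtype.ext h), fun u v hu _ => by cases hu⟩
    have : K.oddComponents.ncard ≤ 1 :=
      (Set.ncard_le_one_iff (Set.toFinite _)).2 fun {a b} _ _ => (hone a).trans (hone b).symm
    omega
  set S : Finset V := univ.filter fun v => Sum.inl v ∈ U with hS
  set B : K.ConnectedComponent → Finset V := fun c =>
    univ.filter fun v => ∃ h : Sum.inl v ∉ U, K.connectedComponentMk ⟨_, (hverts _).2 h⟩ = c with hB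
  have hSr : #S + r ≤ U.ncard := by
    have h₁ : ((S.disjSum (univ : Finset (Fin r)) : Finset (V ⊕ Fin r)) : Set (V ⊕ Fin r)) ⊆ U := by
      rintro (v | i) h
      · simpa [hS] using h
      · exact hinr i
    have h₂ := Set.ncard_le_ncard h₁
    rwa [Set.ncard_coe_finset, card_disjSum, card_univ, Fintype.card_fin] at h₂
  have hBc : ∀ c, #(B c) ≤ c.supp.ncard := by
    intro c
    rw [← Set.ncard_image_of_injective c.supp Subtype.val_injective,
      ← card_image_of_injective (B c) (Sum.inl_injective (β := Fin r)), ← Set.ncard_coe_finset]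
    refine Set.ncard_le_ncard fun w hw => ?_
    obtain ⟨v, hv, rfl⟩ := mem_image.1 (mem_coe.1 hw)
    obtain ⟨h, hc⟩ := (mem_filter.1 hv).2
    exact ⟨⟨_, (hverts _).2 h⟩, hc, rfl⟩
  have hhalf : ∑ c, #(B c) / 2 ≤ ∑ c : K.ConnectedComponent, c.supp.ncard / 2 :=
    sum_le_sum fun c _ => Nat.div_le_div_right (hBc c)
  let e := (Fintype.equivFin K.ConnectedComponent).symm
  refine ⟨_, S, fun i => B (e i), fun u v huv => ?_, ?_⟩
  · by_cases hu : Sum.inl u ∈ U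
    · exact Or.inl (mem_filter.2 ⟨mem_univ u, hu⟩)
    by_cases hv : Sum.inl v ∈ U
    · exact Or.inr (Or.inl (mem_filter.2 ⟨mem_univ v, hv⟩))
    refine Or.inr (Or.inr ⟨e.symm (K.connectedComponentMk ⟨_, (hverts _).2 hu⟩), ?_, ?_⟩)
    · simp only [e.apply_symm_apply]
      exact mem_filter.2 ⟨mem_univ u, hu, rfl⟩
    · simp only [e.apply_symm_apply]
      refine mem_filter.2 ⟨mem_univ v, hv, ConnectedComponent.sound (hKadj _ _ ?_).reachable⟩
      refine ⟨fun h => huv.ne' (Sum.inl_injective h), fun u' v' hu' hv' => ?_⟩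
      rw [← Sum.inl_injective hu', ← Sum.inl_injective hv']
      exact huv.symm
  -- The halves sum to at most (|V| + r − 2|U| − 2)/2 = r + k − |U|, and |S| ≤ |U| − r.
  · rw [e.sum_comp fun c => #(B c) / 2]
    omega

end GenRT

/-! ### Counting copies, and the extremal graphs -/

namespace GenRT
open SimpleGraph

theorem copyCount_eq_ncard {V W : Type*} [Fintype V] (G : SimpleGraph V) (T : SimpleGraph W) :
    G.copyCount T = {G' : G.Subgraph | Nonempty (T ≃g G'.coe)}.ncard := by
  classical
  rw [copyCount, ← Set.ncard_coe_finset]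
  congr 1
  ext G'
  simp only [coe_filter, mem_univ, true_and]

theorem copyCount_top_eq_card_cliqueFinset {V : Type*} [Fintype V] [DecidableEq V]
    (G : SimpleGraph V) [DecidableRel G.Adj] (ℓ : ℕ) :
    G.copyCount (⊤ : SimpleGraph (Fin ℓ)) = #(G.cliqueFinset ℓ) := by
  have hadj : ∀ G' : G.Subgraph, Nonempty ((⊤ : SimpleGraph (Fin ℓ)) ≃g G'.coe) →
      ∀ u v, G'.Adj u v ↔ u ∈ G'.verts ∧ v ∈ G'.verts ∧ u ≠ v := by
    rintro G' ⟨e⟩ u v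
    refine ⟨fun h => ⟨h.fst_mem, h.snd_mem, h.ne⟩, fun ⟨hu, hv, huv⟩ => ?_⟩
    have h : G'.coe.Adj ⟨u, hu⟩ ⟨v, hv⟩ := by
      rw [← e.symm.map_adj_iff, top_adj]
      exact fun h => huv (congrArg Subtype.val (e.symm.injective h))
    exact h
  rw [copyCount_eq_ncard, ← Set.ncard_coe_finset]
  refine Set.ncard_congr (fun G' _ => (Set.toFinite G'.verts).toFinset) (fun G' hG' => ?_)
    (fun G₁ G₂ h₁ h₂ h => ?_) fun s hs => ?_
  · refine G.mem_cliqueFinset_iff.2 ⟨fun u hu v hv huv => ?_, ?_⟩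
    · exact ((hadj G' hG' u v).2 ⟨by simpa using hu, by simpa using hv, huv⟩).adj_sub
    · obtain ⟨e⟩ := hG'
      rw [← Set.ncard_eq_toFinset_card, ← Nat.card_coe_set_eq, ← Nat.card_congr e.toEquiv,
        Nat.card_fin]
  · have hverts : G₁.verts = G₂.verts := Set.Finite.toFinset_inj.1 h
    refine Subgraph.ext hverts ?_
    ext u v
    rw [hadj G₁ h₁, hadj G₂ h₂, hverts]
  · obtain ⟨hcl, hcard⟩ := G.mem_cliqueFinset_iff.1 hs
    have hiso : Nonempty ((⊤ : SimpleGraph (Fin ℓ)) ≃g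
        ((⊤ : G.Subgraph).induce (s : Set V)).coe) := by
      let e : Fin ℓ ≃ s := (s.equivFinOfCardEq hcard).symm
      refine ⟨⟨e, fun {i j} => ?_⟩⟩
      rw [Subgraph.coe_adj, Subgraph.induce_adj, top_adj]
      refine ⟨fun h hij => h.2.2.ne (by rw [hij]), fun h => ⟨(e i).2, (e j).2, ?_⟩⟩
      exact hcl (e i).2 (e j).2 fun h' => h (e.injective (Subtype.val_injective h'))
    refine ⟨_, hiso, ?_⟩
    ext v
    simp

/-- The graph on `Fin n` in which the first `y` vertices are universal and the first `x + y`
vertices form a clique. -/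
def coreGraph (n x y : ℕ) : SimpleGraph (Fin n) where
  Adj u v := u ≠ v ∧ (u.val < y ∨ v.val < y ∨ (u.val < x + y ∧ v.val < x + y))
  symm := ⟨fun _ _ h => ⟨h.1.symm, by tauto⟩⟩
  loopless := ⟨fun _ h => h.1 rfl⟩

instance (n x y : ℕ) : DecidableRel (coreGraph n x y).Adj := fun u v =>
  inferInstanceAs (Decidable (u ≠ v ∧ _))

theorem card_fin_filter_lt {n m : ℕ} (h : m ≤ n) : #{v : Fin n | v.val < m} = m := by
  rw [Fin.card_filter_val_lt, min_eq_right h]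

theorem choose_le_card_cliqueFinset_coreGraph {n x y : ℕ} (h : n ≤ x + y) (ℓ : ℕ) :
    n.choose ℓ ≤ #((coreGraph n x y).cliqueFinset ℓ) := by
  calc n.choose ℓ = #(powersetCard ℓ (univ : Finset (Fin n))) := by simp
    _ ≤ _ := card_le_card fun s hs => (coreGraph n x y).mem_cliqueFinset_iff.2
        ⟨fun u _ v _ huv => ⟨huv, Or.inr (Or.inr ⟨u.2.trans_le h, v.2.trans_le h⟩)⟩,
          (mem_powersetCard.1 hs).2⟩

theorem le_card_cliqueFinset_coreGraph {n x y ℓ : ℕ} (h : x + y ≤ n) (hℓ : 1 ≤ ℓ) :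
    (x + y).choose ℓ + (n - (x + y)) * y.choose (ℓ - 1) ≤
      #((coreGraph n x y).cliqueFinset ℓ) := by
  set X : Finset (Fin n) := {v | v.val < x + y} with hX
  set Y : Finset (Fin n) := {v | v.val < y} with hY
  have hXc : #X = x + y := card_fin_filter_lt h
  have hYc : #Y = y := card_fin_filter_lt (by omega)
  have hYX : Y ⊆ X := fun v hv => by
    simp only [hX, hY, mem_filter, mem_univ, true_and] at hv ⊢
    omega
  have hnot : ∀ v ∈ Xᶜ, ∀ s ∈ powersetCard (ℓ - 1) Y, v ∉ s := fun v hv s hs hvs =>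
    mem_compl.1 hv (hYX ((mem_powersetCard.1 hs).1 hvs))
  set F : Fin n → Finset (Finset (Fin n)) := fun v => (powersetCard (ℓ - 1) Y).image (insert v)
    with hF
  have hFc : ∀ v ∈ Xᶜ, #(F v) = y.choose (ℓ - 1) := by
    intro v hv
    rw [hF, card_image_of_injOn, card_powersetCard, hYc]
    intro s hs t ht hst
    rw [← erase_insert (hnot v hv s hs), ← erase_insert (hnot v hv t ht)]
    exact congrArg (fun u => u.erase v) hst
  have hdisj : (Xᶜ : Set (Fin n)).PairwiseDisjoint F := by
    intro u hu v hv huv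
    refine disjoint_left.2 fun s hs hs' => ?_
    obtain ⟨a, _, rfl⟩ := mem_image.1 hs
    obtain ⟨b, hb, hba⟩ := mem_image.1 hs'
    have : u ∈ insert v b := hba ▸ mem_insert_self u a
    rcases mem_insert.1 this with h | h
    · exact huv h
    · exact hu (mem_coe.2 (hYX ((mem_powersetCard.1 hb).1 h)))
  have hdisj' : Disjoint (powersetCard ℓ X) (Xᶜ.biUnion F) := by
    refine disjoint_left.2 fun s hs hs' => ?_
    obtain ⟨v, hv, hs'⟩ := mem_biUnion.1 hs'
    obtain ⟨a, _, rfl⟩ := mem_image.1 hs'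
    exact mem_compl.1 hv ((mem_powersetCard.1 hs).1 (mem_insert_self v a))
  calc (x + y).choose ℓ + (n - (x + y)) * y.choose (ℓ - 1)
      = #(powersetCard ℓ X ∪ Xᶜ.biUnion F) := by
        rw [card_union_of_disjoint hdisj', card_powersetCard, hXc,
          card_biUnion (by simpa using hdisj), sum_congr rfl hFc, sum_const, card_compl, hXc,
          Fintype.card_fin, smul_eq_mul]
    _ ≤ _ := by
        refine card_le_card fun s hs => (coreGraph n x y).mem_cliqueFinset_iff.2 ?_
        rcases mem_union.1 hs with hs | hs
        · obtain ⟨hs, hc⟩ := mem_powersetCard.1 hs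
          refine ⟨fun u hu v hv huv => ⟨huv, Or.inr (Or.inr ⟨?_, ?_⟩)⟩, hc⟩
          · exact (mem_filter.1 (hs hu)).2
          · exact (mem_filter.1 (hs hv)).2
        · obtain ⟨w, hw, hs⟩ := mem_biUnion.1 hs
          obtain ⟨a, ha, rfl⟩ := mem_image.1 hs
          have hwa := hnot w hw a ha
          obtain ⟨haY, hac⟩ := mem_powersetCard.1 ha
          refine ⟨fun u hu v hv huv => ⟨huv, ?_⟩, ?_⟩
          · rcases mem_insert.1 (mem_coe.1 hu) with rfl | hu
            · rcases mem_insert.1 (mem_coe.1 hv) with rfl | hv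
              · exact absurd rfl huv
              · exact Or.inr (Or.inl (mem_filter.1 (haY hv)).2)
            · exact Or.inl (mem_filter.1 (haY hu)).2
          · rw [card_insert_of_notMem hwa, hac]
            omega

theorem phi_le_card_cliqueFinset_coreGraph {n x y ℓ : ℕ} (h : x + y ≤ n) (hℓ : 1 ≤ ℓ) :
    phi ℓ n x y ≤ #((coreGraph n x y).cliqueFinset ℓ) := by
  refine le_trans (le_of_eq ?_) (Int.ofNat_le.2 (le_card_cliqueFinset_coreGraph h hℓ))
  rw [phi]
  push_cast [Nat.cast_sub h]
  ring

/-- A matching in which each edge meets `Y` or lies inside `X` has at most `|Y| + |X| / 2` edges. -/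
theorem le_of_matchingGraph_isContained {V : Type*} [Fintype V] [DecidableEq V]
    {H : SimpleGraph V} {k : ℕ} (X Y : Finset V)
    (hcov : ∀ u v, H.Adj u v → u ∈ Y ∨ v ∈ Y ∨ (u ∈ X ∧ v ∈ X)) (hk : matchingGraph k ⊑ H) :
    2 * k ≤ 2 * #Y + #X := by
  classical
  obtain ⟨f⟩ := hk
  have hfi : Function.Injective f := f.injective
  have hadj : ∀ i, H.Adj (f (i, 0)) (f (i, 1)) := fun i => f.toHom.map_adj ⟨rfl, by simp⟩
  set P : Finset (Fin k) := univ.filter fun i => f (i, 0) ∈ Y ∨ f (i, 1) ∈ Y with hP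
  have h₁ : #P ≤ #Y := by
    refine card_le_card_of_injOn (fun i => if f (i, 0) ∈ Y then f (i, 0) else f (i, 1))
      (fun i hi => ?_) fun i _ j _ hij => ?_
    · have := (mem_filter.1 hi).2
      by_cases h : f (i, 0) ∈ Y
      · simp [h]
      · simpa [h] using this.resolve_left h
    · by_cases hi : f (i, 0) ∈ Y <;> by_cases hj : f (j, 0) ∈ Y <;> simp only [hi, hj, if_true,
        if_false] at hij <;> exact congrArg Prod.fst (hfi hij)
  have h₂ : 2 * #Pᶜ ≤ #X := by
    have : #(Pᶜ ×ˢ (univ : Finset (Fin 2))) ≤ #X := by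
      refine card_le_card_of_injOn f (fun a ha => ?_) hfi.injOn
      obtain ⟨i, b⟩ := a
      have hi : i ∉ P := mem_compl.1 (mem_product.1 (mem_coe.1 ha)).1
      simp only [hP, mem_filter, mem_univ, true_and, not_or] at hi
      have := ((hcov _ _ (hadj i)).resolve_left hi.1).resolve_left hi.2
      fin_cases b
      · exact this.1
      · exact this.2
    rw [card_product, card_univ, Fintype.card_fin] at this
    omega
  have h₃ : #Pᶜ + #P = k := by rw [card_compl_add_card, Fintype.card_fin]
  omega

/-- The y universal vertices are shared out among the colours, t_j − 1 to each except that `j₀`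
gives up `a`; in exchange `j₀` takes the edges inside the remaining 2a + 1 clique vertices, worth
only `a` disjoint edges. -/
theorem not_arrows_coreGraph {q n a : ℕ} (t : Fin q → ℕ) (ht : ∀ i, 1 ≤ t i) (j₀ : Fin q)
    (ha : a + 1 ≤ t j₀) :
    ¬ Arrows (coreGraph n (2 * a + 1) (Lam t - a)) (fun j => matchingGraph (t j)) := by
  classical
  set y := Lam t - a with hy
  set b : Fin q → ℕ := fun j => if j = j₀ then t j - 1 - a else t j - 1 with hb
  have hsum : ∑ j, b j = y := by
    have h₁ : Lam t = (t j₀ - 1) + ∑ j ∈ univ.erase j₀, (t j - 1) :=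
      (add_sum_erase univ (fun j => t j - 1) (mem_univ j₀)).symm
    have h₂ : ∑ j, b j = b j₀ + ∑ j ∈ univ.erase j₀, b j :=
      (add_sum_erase univ b (mem_univ j₀)).symm
    have h₃ : ∑ j ∈ univ.erase j₀, b j = ∑ j ∈ univ.erase j₀, (t j - 1) :=
      sum_congr rfl fun j hj => if_neg (ne_of_mem_erase hj)
    have h₄ : b j₀ = t j₀ - 1 - a := if_pos rfl
    omega
  let e : Fin y ≃ Σ j, Fin (b j) := Fintype.equivOfCardEq (by simp [hsum])
  let c : Fin n → Fin q := fun v => if h : v.val < y then (e ⟨v, h⟩).1 else j₀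
  -- Universal vertices come first in the order, so the smaller endpoint of any edge meeting one is
  -- universal and its class covers the edge.
  let C : (coreGraph n (2 * a + 1) y).EdgeLabeling (Fin q) := fun p => c p.1.inf
  intro hA
  obtain ⟨j, hj⟩ := hA C
  set Y : Finset (Fin n) := univ.filter fun v => v.val < y ∧ c v = j with hY
  set X : Finset (Fin n) := if j = j₀ then univ.filter fun v => y ≤ v.val ∧ v.val < 2 * a + 1 + y
    else ∅ with hX
  have hYb : #Y ≤ b j := by
    rw [← card_image_of_injective Y Fin.val_injective]
    calc #(Y.image Fin.val)
        ≤ #((univ : Finset (Fin (b j))).image fun i => (e.symm ⟨j, i⟩).val) := by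
          refine card_le_card fun m hm => ?_
          obtain ⟨v, hv, rfl⟩ := mem_image.1 hm
          obtain ⟨hvy, hvj⟩ := (mem_filter.1 hv).2
          have hvj' : (e ⟨v, hvy⟩).1 = j := by simpa [c, hvy] using hvj
          subst hvj'
          exact mem_image.2 ⟨(e ⟨v, hvy⟩).2, mem_univ _, by simp⟩
      _ ≤ b j := card_image_le.trans (by simp)
  have hXc : #X ≤ if j = j₀ then 2 * a + 1 else 0 := by
    rw [hX]
    split_ifs with h
    · rw [← card_image_of_injective _ Fin.val_injective]
      calc _ ≤ #(Ico y (2 * a + 1 + y)) := card_le_card fun m hm => by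
            obtain ⟨v, hv, rfl⟩ := mem_image.1 hm
            exact mem_Ico.2 (mem_filter.1 hv).2
        _ = _ := by simp
    · simp
  have hcov : ∀ u v, (C.labelGraph j).Adj u v → u ≤ v → u ∈ Y ∨ (u ∈ X ∧ v ∈ X) := by
    intro u v huv hle
    obtain ⟨⟨_, h⟩, hc⟩ := (EdgeLabeling.labelGraph_adj u v).1 huv
    have hcu : c u = j := by
      rw [← hc]
      simp [C, hle]
    have hle' : u.val ≤ v.val := hle
    by_cases hu : u.val < y
    · exact Or.inl (mem_filter.2 ⟨mem_univ u, hu, hcu⟩)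
    · have hj₀ : j = j₀ := by
        rw [← hcu]
        exact dif_neg hu
      right
      simp only [hX, hj₀, if_true, mem_filter, mem_univ, true_and]
      omega
  have hk := le_of_matchingGraph_isContained X Y (fun u v huv => ?_) hj
  · have := ht j
    by_cases hjj : j = j₀
    · subst hjj
      simp only [hb, if_true] at hYb hXc
      omega
    · simp only [hb, hjj, if_false] at hYb hXc
      omega
  · rcases le_total u v with h | h
    · rcases hcov u v huv h with h | h
      · exact Or.inl h
      · exact Or.inr (Or.inr h)
    · rcases hcov v u huv.symm h with h | h
      · exact Or.inr (Or.inl h)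
      · exact Or.inr (Or.inr h.symm)

end GenRT

/-! ### Combining the bounds -/

namespace GenRT
open SimpleGraph

/-- Every graph with a good colouring has a small vertex set outside of which all degrees are
small. -/
theorem exists_small_set_degree_le_of_not_arrows {q n : ℕ} (t : Fin q → ℕ) (ht : ∀ i, 1 ≤ t i)
    (G : SimpleGraph (Fin n)) [DecidableRel G.Adj]
    (hG : ¬ Arrows G (fun j => matchingGraph (t j))) :
    ∃ a ≤ supNorm t - 1, a ≤ Lam t ∧ ∃ X : Finset (Fin n), #X ≤ Lam t + a + 1 ∧
      ∀ v ∉ X, G.degree v ≤ Lam t - a := by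
  classical
  obtain ⟨C, hC⟩ := not_forall.1 hG
  rw [not_exists] at hC
  have hcover := fun j => exists_cover_of_matchingGraph_free (C.labelGraph j) (k := t j - 1) (by
    rw [Nat.sub_add_cancel (ht j)]
    exact hC j)
  choose m S B hcov hcard using hcover
  refine exists_small_set_degree_le G (univ.biUnion S) (fun p : Σ j, Fin (m j) => B p.1 p.2)
    (fun u v huv => ?_) ?_ fun p => ?_
  · have hlab : (C.labelGraph (C ⟨s(u, v), huv⟩)).Adj u v :=
      (EdgeLabeling.labelGraph_adj u v).2 ⟨huv, rfl⟩
    rcases hcov _ u v hlab with h | h | ⟨i, hu, hv⟩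
    · exact Or.inl (mem_biUnion.2 ⟨_, mem_univ _, h⟩)
    · exact Or.inr (Or.inl (mem_biUnion.2 ⟨_, mem_univ _, h⟩))
    · exact Or.inr (Or.inr ⟨⟨_, i⟩, hu, hv⟩)
  · rw [Fintype.sum_sigma]
    calc _ ≤ ∑ j, #(S j) + ∑ j, ∑ i, #(B j i) / 2 := Nat.add_le_add_right card_biUnion_le _
      _ = ∑ j, (#(S j) + ∑ i, #(B j i) / 2) := sum_add_distrib.symm
      _ ≤ _ := sum_le_sum fun j _ => hcard j
  · have h₁ : #(B p.1 p.2) / 2 ≤ ∑ i, #(B p.1 i) / 2 :=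
      single_le_sum (f := fun i => #(B p.1 i) / 2) (fun _ _ => Nat.zero_le _) (mem_univ p.2)
    have h₂ := hcard p.1
    have h₃ : t p.1 ≤ supNorm t := le_sup (f := t) (mem_univ p.1)
    omega

theorem exists_eq_supNorm {q : ℕ} (hq : 1 ≤ q) (t : Fin q → ℕ) : ∃ j, t j = supNorm t := by
  obtain ⟨j, _, hj⟩ := exists_mem_eq_sup univ ⟨(⟨0, hq⟩ : Fin q), mem_univ _⟩ t
  exact ⟨j, hj.symm⟩

theorem card_cliqueFinset_coreGraph_le_matchingGRT {q n a ℓ : ℕ} (t : Fin q → ℕ)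
    (ht : ∀ i, 1 ≤ t i) (j₀ : Fin q) (ha : a + 1 ≤ t j₀) :
    #((coreGraph n (2 * a + 1) (Lam t - a)).cliqueFinset ℓ) ≤ matchingGRT ℓ n t :=
  (isGreatest_matchingGRT ℓ n t ht).2
    ⟨_, not_arrows_coreGraph t ht j₀ ha, copyCount_top_eq_card_cliqueFinset _ ℓ⟩

/-- The value `matchingGRT ℓ n t` is the number of `ℓ`-cliques of a non-arrowing graph. -/
theorem exists_card_cliqueFinset_eq_matchingGRT {q : ℕ} (ℓ n : ℕ) (t : Fin q → ℕ)
    (ht : ∀ i, 1 ≤ t i) :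
    ∃ (G : SimpleGraph (Fin n)) (_ : DecidableRel G.Adj),
      ¬ Arrows G (fun j => matchingGraph (t j)) ∧ #(G.cliqueFinset ℓ) = matchingGRT ℓ n t := by
  classical
  obtain ⟨G, hG, hcount⟩ := (isGreatest_matchingGRT ℓ n t ht).1
  exact ⟨G, inferInstance, hG, (copyCount_top_eq_card_cliqueFinset G ℓ).symm.trans hcount⟩

theorem matchingGRT_le_choose {q : ℕ} (ℓ n : ℕ) (t : Fin q → ℕ) (ht : ∀ i, 1 ≤ t i) :
    matchingGRT ℓ n t ≤ n.choose ℓ := by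
  obtain ⟨G, _, _, hcount⟩ := exists_card_cliqueFinset_eq_matchingGRT ℓ n t ht
  rw [← hcount]
  calc #(G.cliqueFinset ℓ) ≤ #(powersetCard ℓ (univ : Finset (Fin n))) :=
        card_le_card fun s hs => mem_powersetCard.2
          ⟨subset_univ s, (G.mem_cliqueFinset_iff.1 hs).2⟩
    _ = n.choose ℓ := by simp

theorem matchingGRT_le_max_phi {q ℓ n : ℕ} (hℓ : 2 ≤ ℓ) (t : Fin q → ℕ) (ht : ∀ i, 1 ≤ t i)
    (hs : 1 ≤ supNorm t) (hn : supNorm t + Lam t ≤ n) :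
    (matchingGRT ℓ n t : ℤ) ≤ max (phi ℓ n 1 (Lam t))
      (phi ℓ n (2 * (supNorm t - 1) + 1) (Lam t - (supNorm t - 1))) := by
  obtain ⟨G, _, hG, hcount⟩ := exists_card_cliqueFinset_eq_matchingGRT ℓ n t ht
  obtain ⟨a, has, haL, X, hX, hdeg⟩ := exists_small_set_degree_le_of_not_arrows t ht G hG
  have hsL := supNorm_le_Lam_add_one t
  -- Enlarging to exactly Λ + a + 1 vertices keeps the degree bound outside and turns the clique
  -- count into φ; there is room since a + 1 ≤ ‖t‖_∞.
  obtain ⟨X', hXX', hX'⟩ := exists_superset_card_eq hX (by rw [Fintype.card_fin]; omega)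
  have hle := card_cliqueFinset_le_of_degree_le G (ℓ := ℓ) X' fun v hv =>
    hdeg v fun h => hv (hXX' h)
  rw [hcount, hX', Fintype.card_fin] at hle
  refine le_trans ?_ (phi_le_max (L := Lam t) (n := n) hℓ (by omega) (by omega) has)
  have he : 2 * a + 1 + (Lam t - a) = Lam t + a + 1 := by omega
  refine (Int.ofNat_le.2 hle).trans (le_of_eq ?_)
  rw [phi, he, Nat.cast_add, Nat.cast_mul, Nat.cast_sub (by omega : Lam t + a + 1 ≤ n)]
  push_cast [Nat.cast_sub haL]
  ring

end GenRT

theorem theorem2 (q ℓ n : ℕ) (hq : 1 ≤ q) (hℓ : 2 ≤ ℓ) (t : Fin q → ℕ) (ht : ∀ i, 1 ≤ t i) :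
    (max ℓ (GenRT.supNorm t + GenRT.Lam t) ≤ n →
      (GenRT.matchingGRT ℓ n t : ℤ) =
        max (GenRT.phi ℓ n 1 (GenRT.Lam t))
          (GenRT.phi ℓ n (2 * GenRT.supNorm t - 1) (GenRT.Lam t + 1 - GenRT.supNorm t))) ∧
    (n < ℓ → GenRT.matchingGRT ℓ n t = 0) ∧
    (ℓ ≤ n → n ≤ GenRT.supNorm t + GenRT.Lam t →
      GenRT.matchingGRT ℓ n t = n.choose ℓ) := by
  obtain ⟨j₀, hj₀⟩ := GenRT.exists_eq_supNorm hq t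
  have hs : 1 ≤ GenRT.supNorm t := hj₀ ▸ ht j₀
  have hsL := GenRT.supNorm_le_Lam_add_one t
  have hx : 2 * GenRT.supNorm t - 1 = 2 * (GenRT.supNorm t - 1) + 1 := by omega
  have hy : GenRT.Lam t + 1 - GenRT.supNorm t = GenRT.Lam t - (GenRT.supNorm t - 1) := by omega
  refine ⟨fun hn => ?_, fun hn => ?_, fun _ hn => ?_⟩
  · have hn' : GenRT.supNorm t + GenRT.Lam t ≤ n := (le_max_right _ _).trans hn
    rw [hx, hy]
    refine le_antisymm (GenRT.matchingGRT_le_max_phi hℓ t ht hs hn') (max_le ?_ ?_)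
    · exact (GenRT.phi_le_card_cliqueFinset_coreGraph (by omega) (by omega)).trans
        (Int.ofNat_le.2 (GenRT.card_cliqueFinset_coreGraph_le_matchingGRT t ht j₀
          (a := 0) (by omega)))
    · exact (GenRT.phi_le_card_cliqueFinset_coreGraph (by omega) (by omega)).trans
        (Int.ofNat_le.2 (GenRT.card_cliqueFinset_coreGraph_le_matchingGRT t ht j₀ (by omega)))
  · exact Nat.le_zero.1 ((GenRT.matchingGRT_le_choose ℓ n t ht).trans_eq
      (Nat.choose_eq_zero_of_lt hn))
  -- For a = ‖t‖_∞ − 1 the clique of the core graph would have ‖t‖_∞ + Λ ≥ n vertices, so the graph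
  -- is complete.
  · exact le_antisymm (GenRT.matchingGRT_le_choose ℓ n t ht)
      ((GenRT.choose_le_card_cliqueFinset_coreGraph (by omega) ℓ).trans
        (GenRT.card_cliqueFinset_coreGraph_le_matchingGRT t ht j₀
          (a := GenRT.supNorm t - 1) (by omega)))
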